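/- Let $G$ be a torsion-free nilpotent group of nilpotency class exactly $3$ that is generated by two elements. Then: (1) $G$ is strongly recurrent self-similar: for every subgroup $H\le G$ of finite index there are a subgroup $K\le H$ of finite index and a surjective homomorphism $f:K\to G$ that is simple, i.e. whose $f$-core is trivial. Here the $f$-core is the subgroup generated by all subgroups $N\le K$ that are normal in $G$ and satisfy $f(N)\le N$. (2) $G$ has a faithful transitive self-similar representation: for some $m\ge 1$ there is an injective homomorphism from $G$ to the automorphism group of the regular rooted $m$-ary tree $\mathcal T_m$ (whose vertices are the finite words over an alphabet $Y$ with $m$ letters) whose image $S$ is transitive on the first level $Y$ of the tree and state-closed. State-closed means that for every $\alpha\in S$ and every word $u$ the state $\alpha_u$, defined by $\alpha(uw)=\alpha(u)\,\alpha_u(w)$ for all words $w$, belongs to $S$. -/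

import Mathlib

/-- A group is torsion-free: no element other than `1` has finite order. -/
def IsTorsionFreeGroup (G : Type*) [Group G] : Prop :=
  ∀ g : G, IsOfFinOrder g → g = 1

/-- A group is 2-generated: it is generated by two elements. -/
def IsTwoGenerated (G : Type*) [Group G] : Prop :=
  ∃ a b : G, Subgroup.closure {a, b} = ⊤

section VirtualEndomorphisms

variable {G : Type*} [Group G]

/-- The core of a homomorphism `f : K → G` defined on a subgroup `K` of `G`: the subgroup
generated by all subgroups `N` of `K` which are normal in `G` and `f`-invariant. -/
def virtualCore {K : Subgroup G} (f : K →* G) : Subgroup G :=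
  sSup {N : Subgroup G | N ≤ K ∧ N.Normal ∧ (N.subgroupOf K).map f ≤ N}

/-- `f : K → G` is simple: its core is trivial. -/
def IsSimpleVirtualEnd {K : Subgroup G} (f : K →* G) : Prop :=
  virtualCore f = ⊥

/-- `f : K → G` is recurrent: it is an epimorphism. -/
def IsRecurrentVirtualEnd {K : Subgroup G} (f : K →* G) : Prop :=
  Function.Surjective f

end VirtualEndomorphisms

/-- `G` is strongly recurrent self-similar: every subgroup `H` of finite index contains a subgroup
`K` of finite index with a simple recurrent virtual endomorphism `K → G`. -/
def IsStronglyRecurrentSelfSimilar (G : Type*) [Group G] : Prop :=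
  ∀ H : Subgroup G, H.FiniteIndex →
    ∃ K : Subgroup G, K ≤ H ∧ K.FiniteIndex ∧
      ∃ f : K →* G, IsSimpleVirtualEnd f ∧ IsRecurrentVirtualEnd f

/-- The group of automorphisms of the regular one-rooted `m`-ary tree: the vertices are the finite
words over the alphabet `Fin m`, the root is the empty word, and the vertices below `u` are the
words that extend `u`. -/
abbrev TreeAut (m : ℕ) : Type :=
  RelIso (fun u v : List (Fin m) => u <+: v) (fun u v : List (Fin m) => u <+: v)

/-- `β` is the state of the tree automorphism `α` at the vertex `u`. There is at most one such `β`,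
and it describes how `α` maps the subtree below `u` to the subtree below `α u`. -/
def IsStateAt {m : ℕ} (α : TreeAut m) (u : List (Fin m)) (β : TreeAut m) : Prop :=
  ∀ w : List (Fin m), α (u ++ w) = α u ++ β w

/-- A group of tree automorphisms is self-similar (state-closed): it contains the states of its
elements at all vertices. -/
def IsStateClosed {m : ℕ} (S : Subgroup (TreeAut m)) : Prop :=
  ∀ α ∈ S, ∀ u : List (Fin m), ∃ β ∈ S, IsStateAt α u β

/-- A group of tree automorphisms is transitive: it acts transitively on the first level. -/
def IsFirstLevelTransitive {m : ℕ} (S : Subgroup (TreeAut m)) : Prop :=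
  ∀ x y : Fin m, ∃ α ∈ S, α [x] = [y]

/-- `G` is transitive self-similar: for some `m ≥ 1` it has a faithful representation by
automorphisms of the `m`-ary tree whose image is state-closed and transitive. -/
def IsTransitiveSelfSimilar (G : Type*) [Group G] : Prop :=
  ∃ m : ℕ, 1 ≤ m ∧ ∃ φ : G →* TreeAut m,
    Function.Injective φ ∧ IsStateClosed φ.range ∧ IsFirstLevelTransitive φ.range

/-! For every n ≥ 2 the assignment x^n ↦ x, y^n ↦ y on the two generators extends to a simple
virtual endomorphism onto `G`. Put z = [y, x], u = [z, x], v = [z, y]; class three makes Γ = ⟨u, v⟩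
central. Let D ≤ G × G be generated by (x^n, x) and (y^n, y). Its iterated commutators are (z^(n²)γ,
z) with γ in Γ, (u^(n³), u) and (v^(n³), v) (`CommutatorSystem.pow`). Since `G` is torsion-free of
class exactly three, z^c is central only for c = 0. Hence an element of D with central first
coordinate has no x, y, z part in its normal form, and its first coordinate is the n³-th power of
its second, which lies in Γ.

So D is the graph of a homomorphism f that takes n³-th roots on central elements. A nontrivial
normal f-invariant subgroup would meet the centre in a nontrivial n³-divisible subgroup of the
finitely generated torsion-free abelian group Γ, which is impossible. The domain has finite index
because it contains powers of x, y, u, v and, up to Γ, of z. It lies in a given H once x^n and y^n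
do.

The tree representation comes from the action on the cosets of the domain, with states given by f;
its kernel lies in the core of f. -/

/-! ### Tree representations from virtual endomorphisms -/

section TreeRepresentation

variable {G : Type*}

/-- The word map on the `ι`-ary tree determined by a map `a` on letters and first-level states `c`. -/
def treeMap {ι : Type*} (a : G → ι → ι) (c : G → ι → G) : G → List ι → List ι
  | _, [] => []
  | g, i :: w => a g i :: treeMap a c (c g i) w

/-- The state at a vertex, obtained by iterating the first-level states. -/
def treeState {ι : Type*} (c : G → ι → G) : G → List ι → G
  | g, [] => g
  | g, i :: w => treeState c (c g i) w

variable {ι : Type*} {a : G → ι → ι} {c : G → ι → G}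

theorem treeMap_append (g : G) (u w : List ι) :
    treeMap a c g (u ++ w) = treeMap a c g u ++ treeMap a c (treeState c g u) w := by
  induction u generalizing g with
  | nil => rfl
  | cons i u ih => simp [treeMap, treeState, ih]

theorem treeMap_prefix (g : G) {u v : List ι} (h : u <+: v) :
    treeMap a c g u <+: treeMap a c g v := by
  obtain ⟨w, rfl⟩ := h
  exact ⟨_, (treeMap_append g u w).symm⟩

variable [Group G]

theorem treeMap_one (ha : ∀ i, a 1 i = i) (hc : ∀ i, c 1 i = 1) (w : List ι) :
    treeMap a c 1 w = w := by
  induction w with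
  | nil => rfl
  | cons i w ih => simp [treeMap, ha, hc, ih]

theorem treeMap_mul (ha : ∀ g h i, a (g * h) i = a g (a h i))
    (hc : ∀ g h i, c (g * h) i = c g (a h i) * c h i) (g h : G) (w : List ι) :
    treeMap a c (g * h) w = treeMap a c g (treeMap a c h w) := by
  induction w generalizing g h with
  | nil => rfl
  | cons i w ih => simp [treeMap, ha, hc, ih]

/-- The representation on the tree determined by an action on letters and a cocycle of states. -/
def treeHom {m : ℕ} {a : G → Fin m → Fin m} {c : G → Fin m → G}
    (ha1 : ∀ i, a 1 i = i) (hc1 : ∀ i, c 1 i = 1)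
    (ha : ∀ g h i, a (g * h) i = a g (a h i))
    (hc : ∀ g h i, c (g * h) i = c g (a h i) * c h i) : G →* TreeAut m where
  toFun g :=
    { toFun := treeMap a c g
      invFun := treeMap a c g⁻¹
      left_inv := fun w => by rw [← treeMap_mul ha hc, inv_mul_cancel, treeMap_one ha1 hc1]
      right_inv := fun w => by rw [← treeMap_mul ha hc, mul_inv_cancel, treeMap_one ha1 hc1]
      map_rel_iff' := by
        intro u v
        refine ⟨fun h => ?_, fun h => treeMap_prefix g h⟩
        have := treeMap_prefix (a := a) (c := c) g⁻¹ h
        simpa [← treeMap_mul ha hc, treeMap_one ha1 hc1] using this }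
  map_one' := RelIso.ext fun w => treeMap_one ha1 hc1 w
  map_mul' g h := RelIso.ext fun w => treeMap_mul ha hc g h w

/-- A simple virtual endomorphism yields a faithful transitive self-similar representation. -/
theorem isTransitiveSelfSimilar_of_isSimpleVirtualEnd {K : Subgroup G} [hK : K.FiniteIndex]
    (f : K →* G) (hf : IsSimpleVirtualEnd f) : IsTransitiveSelfSimilar G := by
  classical
  have e : G ⧸ K ≃ Fin K.index := Finite.equivFinOfCardEq rfl
  let t : Fin K.index → G := fun i => (e.symm i).out
  have ht : ∀ i, ((t i : G) : G ⧸ K) = e.symm i := fun i => QuotientGroup.out_eq' _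
  let a : G → Fin K.index → Fin K.index := fun g i => e (g • e.symm i)
  have hmem : ∀ g i, (t (a g i))⁻¹ * g * t i ∈ K := by
    intro g i
    rw [mul_assoc, ← QuotientGroup.eq, ht, ← smul_eq_mul g, ← MulAction.Quotient.smul_coe, ht]
    simp [a]
  let c : G → Fin K.index → G := fun g i => f ⟨_, hmem g i⟩
  have ha1 : ∀ i, a 1 i = i := fun i => by simp [a]
  have ha : ∀ g h i, a (g * h) i = a g (a h i) := fun g h i => by simp [a, mul_smul]
  have hc1 : ∀ i, c 1 i = 1 := by
    intro i
    rw [← map_one f]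
    refine congrArg f (Subtype.ext ?_)
    simp [ha1]
  have hc : ∀ g h i, c (g * h) i = c g (a h i) * c h i := by
    intro g h i
    simp only [c]
    rw [← map_mul f]
    refine congrArg f (Subtype.ext ?_)
    simp only [Subgroup.coe_mul, ha]
    group
  let φ := treeHom ha1 hc1 ha hc
  have hφ : ∀ g w, φ g w = treeMap a c g w := fun _ _ => rfl
  refine ⟨K.index, Nat.one_le_iff_ne_zero.mpr hK.index_ne_zero, φ, ?_, ?_, ?_⟩
  · have hker : ∀ g ∈ φ.ker, ∀ i, a g i = i ∧ c g i ∈ φ.ker := by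
      intro g hg i
      have h : ∀ w, treeMap a c g w = w := fun w => by
        rw [← hφ, MonoidHom.mem_ker.mp hg]; rfl
      have h' : ∀ w, a g i = i ∧ treeMap a c (c g i) w = w := fun w => by
        have := h (i :: w)
        simpa [treeMap] using this
      refine ⟨(h' []).1, ?_⟩
      rw [MonoidHom.mem_ker]
      exact RelIso.ext fun w => (h' w).2
    have hle : φ.ker ≤ K := by
      intro g hg
      have h := (hker g hg (e (1 : G))).1
      have h2 : g • ((1 : G) : G ⧸ K) = ((1 : G) : G ⧸ K) := by
        simpa [a] using h
      rw [MulAction.Quotient.smul_coe, eq_comm, QuotientGroup.eq] at h2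
      simpa using h2
    rw [← MonoidHom.ker_eq_bot_iff, eq_bot_iff, ← (show virtualCore f = ⊥ from hf)]
    refine le_sSup ⟨hle, inferInstance, ?_⟩
    rintro _ ⟨⟨g, hgK⟩, hg, rfl⟩
    have hg : g ∈ φ.ker := hg
    -- The representative `k` of the trivial coset need not be `1`, so `f g` is realised as a state
    -- of `k * g * k⁻¹` instead of `g`.
    set i := e (1 : G)
    set k := t i
    have hg' : k * g * k⁻¹ ∈ φ.ker := (inferInstance : φ.ker.Normal).conj_mem g hg k
    obtain ⟨h1, h2⟩ := hker _ hg' i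
    convert h2 using 1
    refine congrArg f (Subtype.ext ?_)
    simp only [h1]
    change g = k⁻¹ * (k * g * k⁻¹) * k
    group
  · rintro _ ⟨g, rfl⟩ u
    exact ⟨φ (treeState c g u), ⟨_, rfl⟩, fun w => treeMap_append g u w⟩
  · intro i j
    refine ⟨φ (t j * (t i)⁻¹), ⟨_, rfl⟩, ?_⟩
    rw [hφ]
    have : a (t j * (t i)⁻¹) i = j := by
      simp only [a]
      rw [← ht i, MulAction.Quotient.smul_coe]
      simp [ht]
    simp [treeMap, this]

end TreeRepresentation

/-! ### Commutator calculus and normal forms -/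

section CommutatorCalculus

open Subgroup
open scoped commutatorElement

variable {G : Type*} [Group G]

theorem Subgroup.normal_of_le_center {N : Subgroup G} (h : N ≤ center G) : N.Normal :=
  ⟨fun n hn g => by
    rwa [mem_center_iff.mp (h hn) g, mul_inv_cancel_right]⟩

/-- A nontrivial normal subgroup of a nilpotent group meets the centre nontrivially. -/
theorem Subgroup.Normal.inf_center_ne_bot [Group.IsNilpotent G] {N : Subgroup G} (hN : N.Normal)
    (h : N ≠ ⊥) : N ⊓ center G ≠ ⊥ := by
  -- A noncentral `m` in `N` has a nontrivial commutator with some `g`; it stays in `N` and lies one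
  -- step lower in the upper central series.
  have key : ∀ k, ∀ m ∈ N, m ≠ 1 → m ∈ upperCentralSeries G k →
      ∃ m' ∈ N ⊓ center G, m' ≠ 1 := by
    intro k
    induction k with
    | zero =>
      intro m _ hm1 hm
      simp at hm
      exact absurd hm hm1
    | succ k ih =>
      intro m hm hm1 hmk
      by_cases hc : m ∈ center G
      · exact ⟨m, ⟨hm, hc⟩, hm1⟩
      · rw [mem_center_iff] at hc
        push Not at hc
        obtain ⟨g, hg⟩ := hc
        refine ih (m * g * m⁻¹ * g⁻¹) ?_ ?_ (mem_upperCentralSeries_succ_iff.mp hmk g)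
        · have := N.mul_mem hm (hN.conj_mem _ (N.inv_mem hm) g)
          simpa [mul_assoc] using this
        · intro h1
          apply hg
          rw [mul_inv_eq_one, mul_inv_eq_iff_eq_mul] at h1
          exact h1.symm
  obtain ⟨m, hm1⟩ := Subgroup.ne_bot_iff_exists_ne_one.mp h
  obtain ⟨k, hk⟩ := Group.IsNilpotent.nilpotent G
  obtain ⟨m', hm', h'⟩ := key k m m.2 (by simpa using hm1) (by rw [hk]; trivial)
  intro hbot
  rw [hbot] at hm'
  exact h' (mem_bot.mp hm')

theorem zpow_mul_of_commutator_central {s t w : G} (h : s * t = t * s * w) (hs : Commute w s)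
    (ht : Commute w t) (a b : ℤ) : s ^ a * t ^ b = t ^ b * s ^ a * w ^ (a * b) := by
  have h1 : SemiconjBy t (s * w) s := by
    change t * (s * w) = s * t
    rw [h, mul_assoc]
  have h2 : SemiconjBy (s ^ a) t (t * w ^ a) := by
    have h3 : t * (s * w) ^ a = s ^ a * t := h1.zpow_right a
    change s ^ a * t = t * w ^ a * s ^ a
    rw [← h3, hs.symm.mul_zpow, (hs.symm.zpow_zpow a a).eq, mul_assoc]
  have h4 : s ^ a * t ^ b = (t * w ^ a) ^ b * s ^ a := h2.zpow_right b
  rw [h4, (ht.symm.zpow_right a).mul_zpow, ← zpow_mul, mul_assoc, mul_assoc,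
    (hs.zpow_zpow (a * b) a).eq]

/-- Normal form in a group of class two generated by `x` and `y`. -/
theorem exists_eq_zpow_mul_zpow_mul_zpow {x y z : G} (h : y * x = x * y * z) (hx : Commute z x)
    (hy : Commute z y) {g : G} (hg : g ∈ closure {x, y}) :
    ∃ a b c : ℤ, g = x ^ a * y ^ b * z ^ c := by
  have hxmul : ∀ k a b c : ℤ, x ^ k * (x ^ a * y ^ b * z ^ c) = x ^ (k + a) * y ^ b * z ^ c := by
    intro k a b c
    simp only [zpow_add, mul_assoc]
  have hymul : ∀ k a b c : ℤ,
      y ^ k * (x ^ a * y ^ b * z ^ c) = x ^ a * y ^ (k + b) * z ^ (k * a + c) := by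
    intro k a b c
    calc y ^ k * (x ^ a * y ^ b * z ^ c) = y ^ k * x ^ a * y ^ b * z ^ c := by
          simp only [mul_assoc]
      _ = x ^ a * y ^ k * (z ^ (k * a) * y ^ b) * z ^ c := by
          rw [zpow_mul_of_commutator_central h hy hx]
          simp only [mul_assoc]
      _ = x ^ a * y ^ (k + b) * z ^ (k * a + c) := by
          rw [(hy.zpow_zpow _ _).eq]
          simp only [zpow_add, mul_assoc]
  induction hg using closure_induction_left with
  | one => exact ⟨0, 0, 0, by simp⟩
  | mul_left s hs g _ ih =>
    obtain ⟨a, b, c, rfl⟩ := ih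
    rcases hs with rfl | rfl
    · exact ⟨_, _, _, by simpa using hxmul 1 a b c⟩
    · exact ⟨_, _, _, by simpa using hymul 1 a b c⟩
  | inv_mul_cancel s hs g _ ih =>
    obtain ⟨a, b, c, rfl⟩ := ih
    rcases hs with rfl | rfl
    · exact ⟨_, _, _, by simpa using hxmul (-1) a b c⟩
    · exact ⟨_, _, _, by simpa using hymul (-1) a b c⟩

/-- Elements `x, y` together with their commutators `z = [y, x]`, `u = [z, x]`, `v = [z, y]`,
where `u` and `v` are central. -/
structure CommutatorSystem (x y z u v : G) : Prop where
  yx : y * x = x * y * z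
  zx : z * x = x * z * u
  zy : z * y = y * z * v
  hu : u ∈ center G
  hv : v ∈ center G

namespace CommutatorSystem

variable {x y z u v : G}

theorem closure_le_center (S : CommutatorSystem x y z u v) : closure {u, v} ≤ center G := by
  rw [closure_le]
  rintro _ (rfl | rfl)
  exacts [S.hu, S.hv]

theorem normal_closure (S : CommutatorSystem x y z u v) : (closure {u, v}).Normal :=
  normal_of_le_center S.closure_le_center

theorem zpow_z_mul_zpow_x (S : CommutatorSystem x y z u v) (a b : ℤ) :
    z ^ a * x ^ b = x ^ b * z ^ a * u ^ (a * b) :=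
  zpow_mul_of_commutator_central S.zx ((mem_center_iff.mp S.hu z).symm)
    ((mem_center_iff.mp S.hu x).symm) a b

theorem zpow_z_mul_zpow_y (S : CommutatorSystem x y z u v) (a b : ℤ) :
    z ^ a * y ^ b = y ^ b * z ^ a * v ^ (a * b) :=
  zpow_mul_of_commutator_central S.zy ((mem_center_iff.mp S.hv z).symm)
    ((mem_center_iff.mp S.hv y).symm) a b

/-- Modulo the central subgroup generated by `u` and `v`, the element `z` commutes with `x` and
`y`. -/
theorem relations_of_ker (S : CommutatorSystem x y z u v) {Q : Type*} [Group Q] (q : G →* Q)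
    (hq : closure {u, v} ≤ q.ker) :
    q y * q x = q x * q y * q z ∧ Commute (q z) (q x) ∧ Commute (q z) (q y) := by
  have h1 : q u = 1 := hq (subset_closure (by simp))
  have h2 : q v = 1 := hq (subset_closure (by simp))
  refine ⟨by simp only [← map_mul, S.yx], ?_, ?_⟩
  · change q z * q x = q x * q z
    rw [← map_mul, S.zx, map_mul, h1, mul_one, map_mul]
  · change q z * q y = q y * q z
    rw [← map_mul, S.zy, map_mul, h2, mul_one, map_mul]

theorem exists_zpow_y_mul_zpow_x (S : CommutatorSystem x y z u v) (b a : ℤ) :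
    ∃ γ ∈ closure {u, v}, y ^ b * x ^ a = x ^ a * y ^ b * z ^ (b * a) * γ := by
  have := S.normal_closure
  obtain ⟨h1, h2, h3⟩ := S.relations_of_ker (QuotientGroup.mk' (closure {u, v}))
    (by rw [QuotientGroup.ker_mk'])
  have h := zpow_mul_of_commutator_central h1 h3 h2 b a
  simp only [← map_zpow, ← map_mul] at h
  exact ⟨(x ^ a * y ^ b * z ^ (b * a))⁻¹ * (y ^ b * x ^ a), QuotientGroup.eq.mp h.symm,
    (mul_inv_cancel_left _ _).symm⟩

theorem exists_normal_form (S : CommutatorSystem x y z u v) {g : G} (hg : g ∈ closure {x, y}) :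
    ∃ a b c : ℤ, ∃ γ ∈ closure {u, v}, g = x ^ a * y ^ b * z ^ c * γ := by
  have := S.normal_closure
  obtain ⟨h1, h2, h3⟩ := S.relations_of_ker (QuotientGroup.mk' (closure {u, v}))
    (by rw [QuotientGroup.ker_mk'])
  obtain ⟨a, b, c, h⟩ := exists_eq_zpow_mul_zpow_mul_zpow h1 h2 h3
    (g := QuotientGroup.mk' (closure {u, v}) g) (by
      rw [← Set.image_pair, ← MonoidHom.map_closure]
      exact mem_map_of_mem _ hg)
  simp only [← map_zpow, ← map_mul] at h
  exact ⟨a, b, c, (x ^ a * y ^ b * z ^ c)⁻¹ * g, QuotientGroup.eq.mp h.symm,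
    (mul_inv_cancel_left _ _).symm⟩

/-- The error `γ` in the first commutator is central, so it drops out of the next ones, where the
cubes of `n` are exact. -/
theorem pow (S : CommutatorSystem x y z u v) (n : ℤ) :
    ∃ γ ∈ closure {u, v}, CommutatorSystem (x ^ n) (y ^ n) (z ^ (n * n) * γ)
      (u ^ (n * n * n)) (v ^ (n * n * n)) := by
  obtain ⟨γ, hγ, h⟩ := S.exists_zpow_y_mul_zpow_x n n
  have hc := fun g => mem_center_iff.mp (S.closure_le_center hγ) g
  refine ⟨γ, hγ, by rw [h]; simp only [mul_assoc], ?_, ?_, zpow_mem S.hu _, zpow_mem S.hv _⟩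
  · rw [mul_assoc, ← hc, ← mul_assoc, S.zpow_z_mul_zpow_x, mul_assoc, hc]
    simp only [mul_assoc]
  · rw [mul_assoc, ← hc, ← mul_assoc, S.zpow_z_mul_zpow_y, mul_assoc, hc]
    simp only [mul_assoc]

/-- Pairing a dilated system with the original one gives a single normal form for both coordinates
of the graph. -/
theorem prod {G' : Type*} [Group G'] {x' y' z' u' v' : G'} (S : CommutatorSystem x y z u v)
    (S' : CommutatorSystem x' y' z' u' v') :
    CommutatorSystem (x, x') (y, y') (z, z') (u, u') (v, v') where
  yx := Prod.ext S.yx S'.yx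
  zx := Prod.ext S.zx S'.zx
  zy := Prod.ext S.zy S'.zy
  hu := mem_center_iff.mpr fun g =>
    Prod.ext (mem_center_iff.mp S.hu g.1) (mem_center_iff.mp S'.hu g.2)
  hv := mem_center_iff.mpr fun g =>
    Prod.ext (mem_center_iff.mp S.hv g.1) (mem_center_iff.mp S'.hv g.2)

/-- If no nontrivial power of `z` is central, then the normal form of a central element is
trivial modulo the subgroup generated by `u` and `v`. -/
theorem exponents_eq_zero (S : CommutatorSystem x y z u v)
    (hz : ∀ c : ℤ, z ^ c ∈ center G → c = 0) {a b c : ℤ} {γ : G} (hγ : γ ∈ closure {u, v})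
    (h : x ^ a * y ^ b * z ^ c * γ ∈ center G) : a = 0 ∧ b = 0 ∧ c = 0 := by
  have := S.normal_closure
  set q := QuotientGroup.mk' (closure {u, v}) with hq
  obtain ⟨h1, h2, h3⟩ := S.relations_of_ker q (by rw [hq, QuotientGroup.ker_mk'])
  have hz' : ∀ c : ℤ, q z ^ c = 1 → c = 0 := by
    intro c hc
    rw [← map_zpow] at hc
    exact hz c (S.closure_le_center ((QuotientGroup.eq_one_iff _).mp hc))
  have hxyz : x ^ a * y ^ b * z ^ c ∈ center G := by
    have := mul_mem h (inv_mem (S.closure_le_center hγ))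
    simpa using this
  have hcomm : ∀ g, Commute (q g) (q x ^ a * q y ^ b * q z ^ c) := by
    intro g
    have := congrArg q (mem_center_iff.mp hxyz g)
    simpa [Commute, SemiconjBy] using this
  -- Stripping the factors that commute with `q x` leaves `q y ^ b`; its commutator with `q x` is `q
  -- z ^ b`, which must vanish.
  have hb : b = 0 := by
    have e1 := (hcomm x).mul_right (h2.symm.zpow_right (-c))
    have e2 := ((Commute.refl (q x)).zpow_right (-a)).mul_right e1
    have e3 : Commute (q x) (q y ^ b) := by simpa [mul_assoc] using e2
    have e4 := zpow_mul_of_commutator_central h1 h3 h2 b 1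
    rw [zpow_one, e3.eq, eq_comm, mul_eq_left, mul_one] at e4
    exact hz' b e4
  subst hb
  have ha : a = 0 := by
    have e1 := (hcomm y).mul_right (h3.symm.zpow_right (-c))
    have e3 : Commute (q y) (q x ^ a) := by simpa [mul_assoc] using e1
    have e4 := zpow_mul_of_commutator_central h1 h3 h2 1 a
    rw [zpow_one, e3.eq, eq_comm, mul_eq_left, one_mul] at e4
    exact hz' a e4
  subst ha
  exact ⟨rfl, rfl, hz c (by simpa using hxyz)⟩

end CommutatorSystem

end CommutatorCalculus

/-! ### Finite index from powers of generators and commutators -/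

section FiniteIndex

open Subgroup
open scoped commutatorElement

variable {G : Type*} [Group G]

theorem Subgroup.relIndex_sup_zpowers_ne_zero {L : Subgroup G} {s : G} (hs : ∀ g, ⁅s, g⁆ ∈ L)
    {m : ℕ} (hm : m ≠ 0) (hsm : s ^ m ∈ L) : L.relIndex (L ⊔ zpowers s) ≠ 0 := by
  have hnorm : zpowers s ≤ normalizer (L : Set G) := by
    rw [zpowers_le, mem_normalizer_iff]
    intro h
    have h1 : s * h * s⁻¹ = ⁅s, h⁆ * h := by simp [commutatorElement_def]
    rw [h1]
    exact (L.mul_mem_cancel_left (hs h)).symm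
  rw [sup_comm]
  have : NeZero m := ⟨hm⟩
  -- As `s` normalizes `L`, the powers `s ^ i` with `i < m` represent all cosets.
  let q : Fin m → ↥(zpowers s ⊔ L) ⧸ L.subgroupOf (zpowers s ⊔ L) := fun i =>
    QuotientGroup.mk ⟨s ^ (i : ℕ), mem_sup_left (npow_mem_zpowers s i)⟩
  have hq : Function.Surjective q := by
    intro h
    induction h using QuotientGroup.induction_on with
    | H h =>
      obtain ⟨h, hh⟩ := h
      have hh' := hh
      rw [← SetLike.mem_coe, coe_mul_of_left_le_normalizer_right _ _ hnorm] at hh'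
      obtain ⟨_, ⟨k, rfl⟩, l, hl, rfl⟩ := hh'
      have hm0 : (m : ℤ) ≠ 0 := Int.natCast_ne_zero.mpr hm
      have hk0 := Int.emod_nonneg k hm0
      have hk1 := Int.emod_lt_of_pos k (Int.natCast_pos.mpr (Nat.pos_of_ne_zero hm))
      refine ⟨⟨(k % m).toNat, by omega⟩, QuotientGroup.eq.mpr ?_⟩
      rw [mem_subgroupOf]
      have h2 : s ^ (k % m).toNat = s ^ (k % m) := by
        rw [← zpow_natCast, Int.toNat_of_nonneg hk0]
      have h3 : s ^ k = s ^ (k % m) * (s ^ m) ^ (k / m) := by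
        rw [← zpow_natCast, ← zpow_mul, ← zpow_add, Int.emod_add_mul_ediv]
      change (s ^ (k % m).toNat)⁻¹ * (s ^ k * l) ∈ L
      rw [h2, h3, mul_assoc, inv_mul_cancel_left]
      exact mul_mem (zpow_mem hsm _) hl
  have := Finite.of_surjective q hq
  exact index_ne_zero_of_finite

/-- In a group generated by `x` and `y`, an element commuting with `x` and `y` modulo a normal
subgroup commutes with all elements modulo this subgroup. -/
theorem Subgroup.commutatorElement_mem_of_generators {x y : G} (hxy : closure {x, y} = ⊤)
    {N : Subgroup G} [N.Normal] {s : G} (hx : ⁅s, x⁆ ∈ N) (hy : ⁅s, y⁆ ∈ N) (g : G) :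
    ⁅s, g⁆ ∈ N := by
  have hiff : ∀ h, ⁅s, h⁆ ∈ N ↔ h ∈ (centralizer {(s : G ⧸ N)}).comap (QuotientGroup.mk' N) := by
    intro h
    rw [mem_comap, mem_centralizer_singleton_iff, ← QuotientGroup.eq_one_iff]
    change QuotientGroup.mk' N ⁅s, h⁆ = 1 ↔ _
    rw [map_commutatorElement, commutatorElement_eq_one_iff_mul_comm]
    exact eq_comm
  rw [hiff] at *
  have : closure {x, y} ≤ (centralizer {(s : G ⧸ N)}).comap (QuotientGroup.mk' N) := by
    rw [closure_le]
    rintro _ (rfl | rfl) <;> assumption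
  exact this (hxy ▸ mem_top g)

/-- A subgroup containing powers of `x` and `y`, and powers of their iterated commutators up to
lower terms, has finite index. -/
theorem CommutatorSystem.finiteIndex {x y z u v : G} (S : CommutatorSystem x y z u v)
    (hxy : closure {x, y} = ⊤) {K : Subgroup G} {n m k : ℕ} (hn : n ≠ 0) (hm : m ≠ 0) (hk : k ≠ 0)
    (hx : x ^ n ∈ K) (hy : y ^ n ∈ K) {γ : G} (hγ : γ ∈ closure {u, v}) (hz : z ^ m * γ ∈ K)
    (hu : u ^ k ∈ K) (hv : v ^ k ∈ K) : K.FiniteIndex := by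
  have hcentral : ∀ s ∈ center G, ∀ (L : Subgroup G) (g : G), ⁅s, g⁆ ∈ L := by
    intro s hs L g
    rw [commutatorElement_eq_one_iff_mul_comm.mpr (mem_center_iff.mp hs g).symm]
    exact L.one_mem
  have hΓ := S.normal_closure
  have hzg : ∀ g, ⁅z, g⁆ ∈ closure {u, v} := by
    refine commutatorElement_mem_of_generators hxy ?_ ?_
    · rw [commutatorElement_def, S.zx, mul_assoc x, mem_center_iff.mp S.hu z]
      simpa [← mul_assoc, mem_center_iff.mp S.hu x] using Subgroup.subset_closure (show _ ∈ ({u, v} : Set G) by simp)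
    · rw [commutatorElement_def, S.zy, mul_assoc y, mem_center_iff.mp S.hv z]
      simpa [← mul_assoc, mem_center_iff.mp S.hv y] using Subgroup.subset_closure (show _ ∈ ({u, v} : Set G) by simp)
  set q := QuotientGroup.mk' (closure {u, v}) with hq
  have hzq : zpowers (q z) ≤ center (G ⧸ closure {u, v}) := by
    rw [zpowers_le, mem_center_iff]
    intro g
    induction g using QuotientGroup.induction_on with
    | H g =>
      symm
      rw [← commutatorElement_eq_one_iff_mul_comm]
      change ⁅q z, q g⁆ = 1
      rw [← map_commutatorElement]
      exact (QuotientGroup.eq_one_iff _).mpr (hzg g)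
  have := normal_of_le_center hzq
  -- This preimage of `⟨q z⟩` absorbs all commutators with `x` and `y`; it lies in `L₃` below.
  have hN : ((zpowers (q z)).comap q).Normal := inferInstance
  have hzN : z ∈ (zpowers (q z)).comap q := mem_zpowers (q z)
  have hyx : ⁅y, x⁆ ∈ (zpowers (q z)).comap q := by
    have h := hN.conj_mem z hzN (x * y)
    rwa [commutatorElement_def, S.yx, mul_assoc _ _ x⁻¹, ← mul_inv_rev, mul_assoc] at *
  have hxg : ∀ g, ⁅x, g⁆ ∈ (zpowers (q z)).comap q := by
    refine commutatorElement_mem_of_generators hxy (by simp) ?_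
    rw [← commutatorElement_inv]
    exact inv_mem hyx
  have hyg : ∀ g, ⁅y, g⁆ ∈ (zpowers (q z)).comap q :=
    commutatorElement_mem_of_generators hxy hyx (by simp)
  -- Adjoin `u, v, z, y, x` in turn: each has a power in the preceding subgroup and all its
  -- commutators there, so every step has finite index.
  set L₁ := K ⊔ zpowers u with hL₁
  set L₂ := L₁ ⊔ zpowers v with hL₂
  set L₃ := L₂ ⊔ zpowers z with hL₃
  set L₄ := L₃ ⊔ zpowers y with hL₄
  set L₅ := L₄ ⊔ zpowers x with hL₅
  have hK₁ : K ≤ L₁ := le_sup_left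
  have hK₂ : K ≤ L₂ := hK₁.trans le_sup_left
  have hK₃ : K ≤ L₃ := hK₂.trans le_sup_left
  have hK₄ : K ≤ L₄ := hK₃.trans le_sup_left
  have hΓ₂ : closure {u, v} ≤ L₂ := by
    rw [closure_le]
    rintro _ (rfl | rfl)
    · exact mem_sup_left (mem_sup_right (mem_zpowers _))
    · exact mem_sup_right (mem_zpowers _)
  have hN₃ : (zpowers (q z)).comap q ≤ L₃ := by
    rintro g ⟨c, hc⟩
    have hc' : q (z ^ c) = q g := by rw [map_zpow]; exact hc
    have h := mul_mem (mem_sup_right (zpow_mem_zpowers z c) : z ^ c ∈ L₃)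
      (mem_sup_left (hΓ₂ (QuotientGroup.eq.mp hc')))
    rwa [mul_inv_cancel_left] at h
  have hN₄ : (zpowers (q z)).comap q ≤ L₄ := hN₃.trans le_sup_left
  have i₁ : K.relIndex L₁ ≠ 0 := relIndex_sup_zpowers_ne_zero (hcentral u S.hu K) hk hu
  have i₂ : L₁.relIndex L₂ ≠ 0 := relIndex_sup_zpowers_ne_zero (hcentral v S.hv _) hk (hK₁ hv)
  have i₃ : L₂.relIndex L₃ ≠ 0 :=
    relIndex_sup_zpowers_ne_zero (fun g => hΓ₂ (hzg g)) hm
      ((mul_mem_cancel_right (hΓ₂ hγ)).mp (hK₂ hz))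
  have i₄ : L₃.relIndex L₄ ≠ 0 :=
    relIndex_sup_zpowers_ne_zero (fun g => hN₃ (hyg g)) hn (hK₃ hy)
  have i₅ : L₄.relIndex L₅ ≠ 0 :=
    relIndex_sup_zpowers_ne_zero (fun g => hN₄ (hxg g)) hn (hK₄ hx)
  have htop : L₅ = ⊤ := by
    rw [eq_top_iff, ← hxy, closure_le]
    rintro _ (rfl | rfl)
    · exact mem_sup_right (mem_zpowers _)
    · exact mem_sup_left (mem_sup_right (mem_zpowers _))
  have h := relIndex_ne_zero_trans (relIndex_ne_zero_trans (relIndex_ne_zero_trans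
    (relIndex_ne_zero_trans i₁ i₂) i₃) i₄) i₅
  rw [htop, relIndex_top_right] at h
  exact ⟨h⟩

end FiniteIndex

/-- A finitely generated torsion-free abelian group has no nontrivial divisible subgroup. -/
theorem Subgroup.eq_bot_of_forall_exists_zpow {A : Type*} [CommGroup A] [Group.FG A]
    {M : Subgroup A} {k : ℤ} (hk : ¬ IsUnit k) (hdiv : ∀ m ∈ M, ∃ m' ∈ M, m = m' ^ k)
    (htf : ∀ (a : A) (r : ℤ), r ≠ 0 → a ^ r = 1 → a = 1) : M = ⊥ := by
  let P : Submodule ℤ (Additive A) := AddSubgroup.toIntSubmodule (Subgroup.toAddSubgroup M)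
  have : Module.Finite ℤ (Additive A) := Module.Finite.iff_addGroup_fg.mpr inferInstance
  -- Nakayama: `P = kP` yields `r ≡ 1` mod `k` annihilating `P`, and `r ≠ 0` because `k` is not a
  -- unit.
  have hP : P.FG := IsNoetherian.noetherian P
  obtain ⟨r, hr, h0⟩ := Submodule.exists_sub_one_mem_and_smul_eq_zero_of_fg_of_le_smul
    (Ideal.span {k}) P hP (by
      intro m hm
      obtain ⟨m', hm', h⟩ := hdiv m.toMul hm
      have h' : m = k • Additive.ofMul m' := congrArg Additive.ofMul h
      rw [h']
      exact Submodule.smul_mem_smul (Ideal.mem_span_singleton_self k) hm')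
  have hr0 : r ≠ 0 := by
    rintro rfl
    rw [Ideal.mem_span_singleton] at hr
    exact hk (isUnit_of_dvd_unit hr (by simp))
  rw [eq_bot_iff]
  intro m hm
  exact htf m r hr0 (congrArg Additive.toMul (h0 (Additive.ofMul m) hm))

/-! ### The dilation as a simple recurrent virtual endomorphism -/

section Main

open Subgroup

variable {G : Type*} [Group G]

/-- A subgroup of `G × G` meeting the second factor trivially is the graph of a virtual
endomorphism. -/
theorem exists_virtualEnd_of_graph {D : Subgroup (G × G)} (h : ∀ d ∈ D, d.1 = 1 → d.2 = 1) :
    ∃ f : D.map (MonoidHom.fst G G) →* G,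
      ∀ d (hd : d ∈ D), f ⟨d.1, mem_map_of_mem (MonoidHom.fst G G) hd⟩ = d.2 := by
  let p : D →* D.map (MonoidHom.fst G G) := (MonoidHom.fst G G).subgroupMap D
  have hp : Function.Bijective p := by
    refine ⟨(injective_iff_map_eq_one p).mpr fun d hd => ?_,
      MonoidHom.subgroupMap_surjective _ _⟩
    have h1 : (d : G × G).1 = 1 := congrArg Subtype.val hd
    exact Subtype.ext (Prod.ext h1 (h d d.2 h1))
  let e := MulEquiv.ofBijective p hp
  refine ⟨((MonoidHom.snd G G).comp D.subtype).comp e.symm.toMonoidHom, fun d hd => ?_⟩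
  have : e.symm ⟨d.1, mem_map_of_mem (MonoidHom.fst G G) hd⟩ = ⟨d, hd⟩ := by
    rw [MulEquiv.symm_apply_eq]
    rfl
  simp [this]

/-- A virtual endomorphism `f` such that `f m` is a root of `m`, lying in a finitely generated
central subgroup, for every central `m` in its domain, is simple. -/
theorem isSimpleVirtualEnd_of_root_on_center [Group.IsNilpotent G] (htf : IsTorsionFreeGroup G)
    {C : Subgroup G} [Group.FG C] (hC : C ≤ center G) {k : ℤ} (hk : ¬ IsUnit k)
    {K : Subgroup G} (f : K →* G)
    (hf : ∀ m : K, (m : G) ∈ center G → f m ∈ C ∧ (m : G) = f m ^ k) :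
    IsSimpleVirtualEnd f := by
  rw [IsSimpleVirtualEnd, virtualCore, sSup_eq_bot]
  rintro N ⟨hNK, hN, hfN⟩
  by_contra hne
  have hMc := hN.inf_center_ne_bot hne
  have hroot : ∀ m ∈ N ⊓ center G, ∃ m' ∈ N ⊓ center G, m' ∈ C ∧ m = m' ^ k := by
    rintro m ⟨hmN, hmc⟩
    obtain ⟨h1, h2⟩ := hf ⟨m, hNK hmN⟩ hmc
    exact ⟨_, ⟨hfN ⟨⟨m, hNK hmN⟩, hmN, rfl⟩, hC h1⟩, h1, h2⟩
  have hMC : N ⊓ center G ≤ C := by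
    intro m hm
    obtain ⟨m', -, h1, rfl⟩ := hroot m hm
    exact zpow_mem h1 _
  let : CommGroup C :=
    { (inferInstance : Group C) with
      mul_comm := fun a b => Subtype.ext (mem_center_iff.mp (hC b.2) a) }
  have hbot : (N ⊓ center G).subgroupOf C = ⊥ := by
    refine eq_bot_of_forall_exists_zpow hk ?_ ?_
    · rintro ⟨m, hmc⟩ hm
      obtain ⟨m', h0, h1, h2⟩ := hroot m hm
      exact ⟨⟨m', h1⟩, h0, Subtype.ext h2⟩
    · intro a r hr ha
      exact Subtype.ext (htf a (isOfFinOrder_iff_zpow_eq_one.mpr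
        ⟨r, hr, congrArg Subtype.val ha⟩))
  rw [subgroupOf_eq_bot, disjoint_iff, inf_of_le_left hMC] at hbot
  exact hMc hbot

/-- If no nontrivial power of `z` is central, then dilations of `x` and `y` provide simple
recurrent virtual endomorphisms. -/
theorem CommutatorSystem.exists_virtualEnd [Group.IsNilpotent G] (htf : IsTorsionFreeGroup G)
    {x y z u v : G} (S : CommutatorSystem x y z u v) (hxy : closure {x, y} = ⊤)
    (hz : ∀ c : ℤ, z ^ c ∈ center G → c = 0) {n : ℕ} (hn : 2 ≤ n) {H : Subgroup G}
    (hx : x ^ n ∈ H) (hy : y ^ n ∈ H) :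
    ∃ K : Subgroup G, K ≤ H ∧ K.FiniteIndex ∧
      ∃ f : K →* G, IsSimpleVirtualEnd f ∧ IsRecurrentVirtualEnd f := by
  obtain ⟨γ, hγ, S'⟩ := S.pow n
  have T := S'.prod S
  set k : ℤ := n * n * n with hk
  have hk0 : k ≠ 0 := by positivity
  set D : Subgroup (G × G) := closure {(x ^ (n : ℤ), x), (y ^ (n : ℤ), y)} with hD
  have hxD : (x ^ (n : ℤ), x) ∈ D := subset_closure (by simp)
  have hyD : (y ^ (n : ℤ), y) ∈ D := subset_closure (by simp)
  have hzD : (z ^ (n * n : ℤ) * γ, z) ∈ D := by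
    have h := T.yx
    rw [← inv_mul_eq_iff_eq_mul] at h
    rw [← h]
    exact mul_mem (inv_mem (mul_mem hxD hyD)) (mul_mem hyD hxD)
  have huD : (u ^ k, u) ∈ D := by
    have h := T.zx
    rw [← inv_mul_eq_iff_eq_mul] at h
    rw [← h]
    exact mul_mem (inv_mem (mul_mem hxD hzD)) (mul_mem hzD hxD)
  have hvD : (v ^ k, v) ∈ D := by
    have h := T.zy
    rw [← inv_mul_eq_iff_eq_mul] at h
    rw [← h]
    exact mul_mem (inv_mem (mul_mem hyD hzD)) (mul_mem hzD hyD)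
  have hδ : ∀ δ ∈ closure {(u ^ k, u), (v ^ k, v)}, δ.2 ∈ closure {u, v} ∧ δ.1 = δ.2 ^ k := by
    intro δ hδ
    induction hδ using closure_induction with
    | mem δ hδ =>
      rcases hδ with rfl | rfl <;> exact ⟨subset_closure (by simp), rfl⟩
    | one => exact ⟨one_mem _, by simp⟩
    | mul a b _ _ ha hb =>
      refine ⟨mul_mem ha.1 hb.1, ?_⟩
      have hc : Commute a.2 b.2 := mem_center_iff.mp (S.closure_le_center hb.1) a.2
      rw [Prod.fst_mul, Prod.snd_mul, hc.mul_zpow, ha.2, hb.2]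
    | inv a _ ha =>
      exact ⟨inv_mem ha.1, by rw [Prod.fst_inv, Prod.snd_inv, inv_zpow, ha.2]⟩
  -- The normal form of `d` in `G × G` has first coordinate with exponents `n * a`, `n * b`, `n * n
  -- * c` modulo `⟨u, v⟩`; centrality kills them, leaving `d = δ`. This gives both well-definedness
  -- and simplicity of `f`.
  have hcenter : ∀ d ∈ D, d.1 ∈ center G → d.2 ∈ closure {u, v} ∧ d.1 = d.2 ^ k := by
    intro d hd hdc
    obtain ⟨a, b, c, δ, hδm, rfl⟩ := T.exists_normal_form hd
    obtain ⟨h1, h2⟩ := hδ δ hδm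
    have hγc : Commute (z ^ (n * n : ℤ)) γ := mem_center_iff.mp (S.closure_le_center hγ) _
    have h3 : x ^ (n * a : ℤ) * y ^ (n * b : ℤ) * z ^ (n * n * c : ℤ) * (γ ^ c * δ.1) ∈
        center G := by
      convert hdc using 1
      change _ = (x ^ (n : ℤ)) ^ a * (y ^ (n : ℤ)) ^ b * (z ^ (n * n : ℤ) * γ) ^ c * δ.1
      rw [hγc.mul_zpow, ← zpow_mul, ← zpow_mul, ← zpow_mul]
      simp only [mul_assoc]
    obtain ⟨ha, hb, hc⟩ := S.exponents_eq_zero hz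
      (mul_mem (zpow_mem hγ c) (h2 ▸ zpow_mem h1 k)) h3
    have hn0 : n ≠ 0 := by positivity
    obtain rfl : a = 0 := by simpa [hn0] using ha
    obtain rfl : b = 0 := by simpa [hn0] using hb
    obtain rfl : c = 0 := by simpa [hn0] using hc
    simpa using ⟨h1, h2⟩
  have hinj : ∀ d ∈ D, d.1 = 1 → d.2 = 1 := by
    intro d hd h1
    have h2 := (hcenter d hd (h1 ▸ one_mem _)).2
    exact htf _ (isOfFinOrder_iff_zpow_eq_one.mpr ⟨k, hk0, h2 ▸ h1⟩)
  obtain ⟨f, hf⟩ := exists_virtualEnd_of_graph hinj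
  have hmem : ∀ {d}, d ∈ D → d.1 ∈ D.map (MonoidHom.fst G G) := fun hd =>
    mem_map_of_mem (MonoidHom.fst G G) hd
  refine ⟨D.map (MonoidHom.fst G G), ?_, ?_, f, ?_, ?_⟩
  · rw [map_le_iff_le_comap, hD, closure_le]
    rintro _ (rfl | rfl)
    · simpa using hx
    · simpa using hy
  · refine S.finiteIndex hxy (n := n) (m := n * n) (k := n * n * n) (by positivity) (by positivity)
      (by positivity) ?_ ?_ hγ ?_ ?_ ?_
    · exact_mod_cast hmem hxD
    · exact_mod_cast hmem hyD
    · exact_mod_cast hmem hzD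
    · have h := hmem huD
      simp only [hk] at h
      exact_mod_cast h
    · have h := hmem hvD
      simp only [hk] at h
      exact_mod_cast h
  · refine isSimpleVirtualEnd_of_root_on_center htf S.closure_le_center (k := k) ?_ f ?_
    · rw [Int.isUnit_iff_natAbs_eq]
      simp only [hk, Int.natAbs_mul, Int.natAbs_natCast, mul_eq_one]
      omega
    · rintro ⟨_, d, hd, rfl⟩ hm
      have := hcenter d hd hm
      rw [← hf d hd] at this
      exact this
  · rw [IsRecurrentVirtualEnd, ← MonoidHom.range_eq_top, eq_top_iff, ← hxy, closure_le]
    rintro _ (rfl | rfl)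
    exacts [⟨_, hf _ hxD⟩, ⟨_, hf _ hyD⟩]

end Main

/-! ### Consequences of class exactly three -/

section NilpotencyClassThree

open Subgroup
open scoped commutatorElement

variable {G : Type*} [Group G]

/-- The iterated commutators of two elements of a nilpotent group of class at most three. -/
theorem exists_commutatorSystem [Group.IsNilpotent G] (h : Group.nilpotencyClass G ≤ 3) (x y : G) :
    ∃ z u v : G, CommutatorSystem x y z u v := by
  have h3 := Subgroup.lowerCentralSeries_eq_bot_iff_nilpotencyClass_le.mpr h
  -- With ⁅s, t⁆ = s t s⁻¹ t⁻¹, collecting to the right brings in the inverses.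
  have hmul : ∀ s t : G, s * t = t * s * ⁅s⁻¹, t⁻¹⁆ := fun s t => by
    rw [commutatorElement_def]; group
  have h1 : ∀ s t : G, ⁅s, t⁆ ∈ (⊤ : Subgroup G).lowerCentralSeries 1 :=
    fun s t => commutator_mem_commutator (mem_top s) (mem_top t)
  have h2 : ∀ s ∈ (⊤ : Subgroup G).lowerCentralSeries 1, ∀ t : G, ⁅s⁻¹, t⁆ ∈ center G := by
    intro s hs t
    have ht : ⁅s⁻¹, t⁆ ∈ (⊤ : Subgroup G).lowerCentralSeries 2 :=
      commutator_mem_commutator (inv_mem hs) (mem_top t)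
    rw [mem_center_iff]
    intro g
    have hg : ⁅⁅s⁻¹, t⁆, g⁆ ∈ (⊤ : Subgroup G).lowerCentralSeries 3 :=
      commutator_mem_commutator ht (mem_top g)
    rw [h3, mem_bot, commutatorElement_eq_one_iff_mul_comm] at hg
    exact hg.symm
  exact ⟨⁅y⁻¹, x⁻¹⁆, _, _, hmul _ _, hmul _ _, hmul _ _, h2 _ (h1 _ _) _, h2 _ (h1 _ _) _⟩

/-- In a torsion-free group of class at least three generated by `x` and `y`, no nontrivial power
of `[y, x]` is central. -/
theorem CommutatorSystem.eq_zero_of_zpow_mem_center [Group.IsNilpotent G]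
    (htf : IsTorsionFreeGroup G) {x y z u v : G} (S : CommutatorSystem x y z u v)
    (hxy : closure {x, y} = ⊤) (h : 2 < Group.nilpotencyClass G) {c : ℤ}
    (hc : z ^ c ∈ center G) : c = 0 := by
  by_contra hc0
  -- If `z ^ c` is central, then `u ^ c = v ^ c = 1`, so `u = v = 1` by torsion-freeness. Then `z`
  -- and hence all commutators are central, and the class is at most two.
  have hu : u = 1 := by
    have e := S.zpow_z_mul_zpow_x c 1
    rw [mem_center_iff.mp hc, eq_comm, mul_eq_left, mul_one] at e
    exact htf _ (isOfFinOrder_iff_zpow_eq_one.mpr ⟨c, hc0, e⟩)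
  have hv : v = 1 := by
    have e := S.zpow_z_mul_zpow_y c 1
    rw [mem_center_iff.mp hc, eq_comm, mul_eq_left, mul_one] at e
    exact htf _ (isOfFinOrder_iff_zpow_eq_one.mpr ⟨c, hc0, e⟩)
  have hz : z ∈ center G := by
    have h1 : closure {x, y} ≤ centralizer {z} := by
      rw [closure_le]
      rintro _ (rfl | rfl) <;> rw [SetLike.mem_coe, mem_centralizer_singleton_iff]
      · rw [S.zx, hu, mul_one]
      · rw [S.zy, hv, mul_one]
    rw [mem_center_iff]
    intro g
    exact mem_centralizer_singleton_iff.mp (h1 (hxy ▸ mem_top g))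
  have hyx : ⁅y, x⁆ ∈ center G := by
    have h1 := (inferInstance : (center G).Normal).conj_mem z hz (x * y)
    rwa [commutatorElement_def, S.yx, mul_assoc _ _ x⁻¹, ← mul_inv_rev, mul_assoc] at *
  have hxg : ∀ g, ⁅x, g⁆ ∈ center G := by
    refine commutatorElement_mem_of_generators hxy (by simp) ?_
    rw [← commutatorElement_inv]
    exact inv_mem hyx
  have hyg : ∀ g, ⁅y, g⁆ ∈ center G :=
    commutatorElement_mem_of_generators hxy hyx (by simp)
  have hall : ∀ g h : G, ⁅g, h⁆ ∈ center G := by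
    intro g h
    refine commutatorElement_mem_of_generators hxy ?_ ?_ h
    · rw [← commutatorElement_inv]
      exact inv_mem (hxg g)
    · rw [← commutatorElement_inv]
      exact inv_mem (hyg g)
  have h2 : Subgroup.upperCentralSeries G 2 = ⊤ := by
    rw [eq_top_iff]
    intro g _
    rw [Subgroup.mem_upperCentralSeries_succ_iff]
    intro h
    rw [Subgroup.upperCentralSeries_one]
    exact hall g h
  exact absurd (Subgroup.upperCentralSeries_eq_top_iff_nilpotencyClass_le.mp h2) (by omega)

end NilpotencyClassThree

theorem theoremA (G : Type*) [Group G] [Group.IsNilpotent G]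
    (hclass : Group.nilpotencyClass G = 3) (htf : IsTorsionFreeGroup G)
    (hgen : IsTwoGenerated G) :
    IsStronglyRecurrentSelfSimilar G ∧ IsTransitiveSelfSimilar G := by
  obtain ⟨x, y, hxy⟩ := hgen
  obtain ⟨z, u, v, S⟩ := exists_commutatorSystem hclass.le x y
  have hrec : IsStronglyRecurrentSelfSimilar G := by
    intro H hH
    -- Normality of the core puts the index-th powers in it; the factor 2 ensures `n ≥ 2` even when
    -- `H = ⊤`.
    have hpow : ∀ g : G, g ^ (2 * H.normalCore.index) ∈ H := fun g => by
      rw [mul_comm, pow_mul]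
      exact pow_mem (H.normalCore_le (H.normalCore.pow_index_mem g)) 2
    have := Nat.pos_of_ne_zero (Subgroup.FiniteIndex.index_ne_zero (H := H.normalCore))
    exact S.exists_virtualEnd htf hxy
      (fun c hc => S.eq_zero_of_zpow_mem_center htf hxy (by omega) hc) (by omega)
      (hpow x) (hpow y)
  obtain ⟨K, -, hK, f, hf, -⟩ := hrec ⊤ inferInstance
  exact ⟨hrec, isTransitiveSelfSimilar_of_isSimpleVirtualEnd f hf⟩
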